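/- Let $K\subset\mathbb{R}$ be a real algebraic number field (a subfield of $\mathbb{R}$ of finite degree over $\mathbb{Q}$). A Pisot number is a real algebraic integer greater than $1$ all of whose other conjugates over $\mathbb{Q}$ have modulus less than $1$. Let $\wp_K$ be the set of Pisot numbers $\theta$ with $\mathbb{Q}(\theta)=K$, let $\theta_1<\theta_2<\theta_3<\cdots$ be the elements of $\wp_K$ in increasing order, let $D_K$ be the set of positive differences of two elements of $\wp_K$, and let $F_K=\{\theta_{n+1}-\theta_n : n\ge 1\}$ be the set of gaps between consecutive elements of $\wp_K$. Then: (i) $1\in D_K$. In fact, $1=\theta-\theta'$ for infinitely many pairs $(\theta,\theta')\in\wp_K\times\wp_K$, and for every $\alpha\in\wp_K$ there are infinitely many natural numbers $q$ such that both $\alpha^q$ and $\alpha^q-1$ belong to $\wp_K$. (ii) $\wp_K\subsetneq D_K$. (iii) If $K\neq\mathbb{Q}$, then $D_K\setminus\wp_K$ is infinite and $F_K$ has at least two elements. -/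

import Mathlib

open scoped IntermediateField

/-- A Pisot number: a real algebraic integer greater than `1` all of whose other conjugates (the
complex roots of its minimal polynomial over `ℚ` different from it) have modulus less than `1`. -/
def IsPisot (θ : ℝ) : Prop :=
  IsIntegral ℤ θ ∧ 1 < θ ∧
    ∀ z : ℂ, Polynomial.aeval z (minpoly ℚ θ) = 0 → z ≠ (θ : ℂ) → ‖z‖ < 1

/-- The set of Pisot numbers `θ` with `ℚ(θ) = K`, for a subfield `K` of `ℝ`. -/
def pisotGenerators (K : IntermediateField ℚ ℝ) : Set ℝ :=
  {θ | IsPisot θ ∧ ℚ⟮θ⟯ = K}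

/-- The set of positive differences of two elements of `pisotGenerators K`. -/
def pisotDifferences (K : IntermediateField ℚ ℝ) : Set ℝ :=
  {x | 0 < x ∧ ∃ a ∈ pisotGenerators K, ∃ b ∈ pisotGenerators K, x = a - b}

/-- The set of gaps `b - a` between two consecutive elements `a < b` of `pisotGenerators K`. -/
def pisotGaps (K : IntermediateField ℚ ℝ) : Set ℝ :=
  {x | ∃ a ∈ pisotGenerators K, ∃ b ∈ pisotGenerators K,
    a < b ∧ (∀ c ∈ pisotGenerators K, ¬ (a < c ∧ c < b)) ∧ x = b - a}

/-- If the elements of `pisotGenerators K` are listed increasingly as `θ 0 < θ 1 < ⋯`, then the gaps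
are exactly the differences `θ (n + 1) - θ n`. -/
theorem pisotGaps_eq_range (K : IntermediateField ℚ ℝ) (θ : ℕ → ℝ) (hθ : StrictMono θ)
    (hr : Set.range θ = pisotGenerators K) :
    pisotGaps K = Set.range (fun n => θ (n + 1) - θ n) := by
  ext x
  unfold pisotGaps
  rw [← hr]
  constructor
  · rintro ⟨_, ⟨m, rfl⟩, _, ⟨n, rfl⟩, hmn, h, rfl⟩
    have h1 := h _ ⟨m + 1, rfl⟩
    simp only [hθ.lt_iff_lt] at h1 hmn
    have h2 : n = m + 1 := by omega
    exact ⟨m, by rw [h2]⟩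
  · rintro ⟨n, rfl⟩
    refine ⟨_, ⟨n, rfl⟩, _, ⟨n + 1, rfl⟩, hθ (Nat.lt_succ_self n), ?_, rfl⟩
    rintro _ ⟨k, rfl⟩
    simp only [hθ.lt_iff_lt]
    omega

/-! Membership in `pisotGenerators K` is read off the embeddings of K: an integer greater than 1
belongs exactly when every embedding other than the inclusion sends it into the open unit disc.
Differences of powers of one α then reduce to estimates on σ(α)^q, which tends to 0. For (i),
recurrence on a torus brings the arguments of all σ(α)^q near 0 at once, so |σ(α)^q - 1| < 1. For
(ii), α = α^q - (α^q - α) with q large. For (iii), some differences α^q - 1 - α^n have a conjugate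
of real part below -1, and a single gap length would produce an infinite arithmetic progression,
impossible with bounded conjugates. -/

open Filter Topology NumberField

/-- The embedding of a subfield of `ℝ` into `ℂ` given by the inclusions. -/
noncomputable def inclusionEmbedding (K : IntermediateField ℚ ℝ) : K →+* ℂ :=
  Complex.ofRealHom.comp (algebraMap K ℝ)

theorem inclusionEmbedding_apply (K : IntermediateField ℚ ℝ) (x : K) :
    inclusionEmbedding K x = ((x : ℝ) : ℂ) := rfl

/-- An integer of `K` that is greater than `1` and whose image under every embedding of `K` other
than the inclusion has modulus less than `1`. -/
def IsDominantInteger (K : IntermediateField ℚ ℝ) (x : K) : Prop :=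
  IsIntegral ℤ x ∧ 1 < (x : ℝ) ∧ ∀ σ : K →+* ℂ, σ ≠ inclusionEmbedding K → ‖σ x‖ < 1

theorem adjoin_coe_eq_of_adjoin_eq_top {K : IntermediateField ℚ ℝ} {x : K} (h : ℚ⟮x⟯ = ⊤) :
    ℚ⟮(x : ℝ)⟯ = K := by
  have := congrArg IntermediateField.lift h
  exact (IntermediateField.lift_adjoin_simple ℚ K x).symm.trans
    (this.trans (IntermediateField.lift_top ℚ K))

/-- A second embedding agreeing with the inclusion at x would take a value of modulus greater than 1
there. -/
theorem IsDominantInteger.adjoin_eq_top {K : IntermediateField ℚ ℝ} [FiniteDimensional ℚ K]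
    {x : K} (hx : IsDominantInteger K x) : ℚ⟮x⟯ = ⊤ := by
  rw [Field.primitive_element_iff_algHom_eq_of_eval ℚ ℂ (fun _ => IsAlgClosed.splits _) x
    (inclusionEmbedding K).toRatAlgHom]
  intro ψ hψ
  by_contra hne
  have h1 : (ψ : K →+* ℂ) ≠ inclusionEmbedding K := by
    rintro h
    apply hne
    ext y
    exact (RingHom.congr_fun h y).symm
  have h2 := hx.2.2 _ h1
  have h3 : (ψ : K →+* ℂ) x = ((x : ℝ) : ℂ) := hψ.symm
  rw [h3, Complex.norm_real, Real.norm_eq_abs] at h2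
  linarith [le_abs_self (x : ℝ), hx.2.1]

theorem coe_mem_pisotGenerators_iff {K : IntermediateField ℚ ℝ} [FiniteDimensional ℚ K] {x : K} :
    (x : ℝ) ∈ pisotGenerators K ↔ IsDominantInteger K x := by
  have hmin : minpoly ℚ (x : ℝ) = minpoly ℚ x := minpoly.algebraMap_eq (algebraMap K ℝ).injective x
  have : NumberField K := { to_finiteDimensional := inferInstance }
  have hint : IsIntegral ℤ (x : ℝ) ↔ IsIntegral ℤ x :=
    isIntegral_algHom_iff (K.val.restrictScalars ℤ) (Subtype.val_injective)
  have hroots := Embeddings.range_eval_eq_rootSet_minpoly K ℂ x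
  have hmem : ∀ z : ℂ, Polynomial.aeval z (minpoly ℚ x) = 0 ↔ ∃ φ : K →+* ℂ, φ x = z := by
    intro z
    have h := Set.ext_iff.1 hroots z
    rw [Polynomial.mem_rootSet_of_ne (minpoly.ne_zero (Algebra.IsIntegral.isIntegral x))] at h
    exact h.symm
  constructor
  · rintro ⟨⟨hi, h1, hc⟩, hK⟩
    refine ⟨hint.1 hi, h1, fun σ hσ => hc _ ?_ ?_⟩
    · rw [hmin]
      exact (hmem _).2 ⟨σ, rfl⟩
    · intro h
      apply hσ
      have h2 : σ.toRatAlgHom = (inclusionEmbedding K).toRatAlgHom := by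
        refine IntermediateField.algHom_ext_of_eq_adjoin ℚ (s := {(x : ℝ)}) hK.symm ?_
        rintro _ rfl
        exact h
      ext y
      exact DFunLike.congr_fun h2 y
  · intro hx
    refine ⟨⟨hint.2 hx.1, hx.2.1, fun z hz hne => ?_⟩,
      adjoin_coe_eq_of_adjoin_eq_top hx.adjoin_eq_top⟩
    rw [hmin] at hz
    obtain ⟨φ, rfl⟩ := (hmem z).1 hz
    refine hx.2.2 φ ?_
    rintro rfl
    exact hne rfl

theorem mem_pisotGenerators_iff {K : IntermediateField ℚ ℝ} [FiniteDimensional ℚ K] {θ : ℝ} :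
    θ ∈ pisotGenerators K ↔ ∃ x : K, (x : ℝ) = θ ∧ IsDominantInteger K x := by
  constructor
  · intro h
    have hK : θ ∈ K := by
      have := IntermediateField.mem_adjoin_simple_self ℚ θ
      rwa [h.2] at this
    exact ⟨⟨θ, hK⟩, rfl, coe_mem_pisotGenerators_iff.1 h⟩
  · rintro ⟨x, rfl, hx⟩
    exact coe_mem_pisotGenerators_iff.2 hx

theorem mk_ne_mk_inclusionEmbedding {K : IntermediateField ℚ ℝ} {σ : K →+* ℂ}
    (hσ : σ ≠ inclusionEmbedding K) :
    InfinitePlace.mk σ ≠ InfinitePlace.mk (inclusionEmbedding K) := by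
  intro h
  rcases InfinitePlace.mk_eq_iff.1 h.symm with h | h
  · exact hσ h.symm
  · apply hσ
    rw [← h]
    ext y
    exact Complex.conj_ofReal _

/-! ### Existence of a Pisot generator, by Minkowski's theorem -/

theorem exists_ringOfIntegers_ne_zero_lt_half (K : Type*) [Field K] [NumberField K]
    (w₀ : InfinitePlace K) :
    ∃ a : 𝓞 K, a ≠ 0 ∧ ∀ w : InfinitePlace K, w ≠ w₀ → w a < 1 / 2 := by
  obtain ⟨B, hB⟩ : ∃ B : NNReal, mixedEmbedding.minkowskiBound K 1 <
      mixedEmbedding.convexBodyLTFactor K * B := by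
    conv => congr; ext; rw [mul_comm]
    exact ENNReal.exists_nat_mul_gt
      (ENNReal.coe_ne_zero.mpr (mixedEmbedding.convexBodyLTFactor_ne_zero K))
      (ne_of_lt (mixedEmbedding.minkowskiBound_lt_top K 1)) |>.imp' (↑) fun _ h => by simpa using h
  -- Only the bound at `w₀` is enlarged, until the convex body is big enough for Minkowski.
  obtain ⟨g, hg, hprod⟩ := mixedEmbedding.adjust_f K (f := fun _ => 1 / 2) (w₁ := w₀) B
    (fun _ _ => by norm_num)
  obtain ⟨a, ha, hlt⟩ := mixedEmbedding.exists_ne_zero_mem_ringOfIntegers_lt K (f := g)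
    (by
      rw [mixedEmbedding.convexBodyLT_volume]
      convert! hB)
  refine ⟨a, ha, fun w hw => ?_⟩
  have := hlt w
  rw [hg w hw] at this
  simpa using this

theorem pisotGenerators_nonempty (K : IntermediateField ℚ ℝ) [FiniteDimensional ℚ K] :
    (pisotGenerators K).Nonempty := by
  have : NumberField K := { to_finiteDimensional := inferInstance }
  obtain ⟨a, ha, hlt⟩ :=
    exists_ringOfIntegers_ne_zero_lt_half K (InfinitePlace.mk (inclusionEmbedding K))
  have h1 := InfinitePlace.one_le_of_lt_one ha (fun z hz => (hlt z hz).trans (by norm_num))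
  rw [InfinitePlace.apply, inclusionEmbedding_apply, Complex.norm_real, Real.norm_eq_abs] at h1
  -- Doubling makes the value strictly greater than 1; the bound 1/2 keeps the other conjugates
  -- below 1.
  have key : ∀ b : 𝓞 K, 1 ≤ ((b : K) : ℝ) →
      (∀ w : InfinitePlace K, w ≠ InfinitePlace.mk (inclusionEmbedding K) → w b < 1 / 2) →
      (pisotGenerators K).Nonempty := by
    intro b hb hlt
    refine ⟨_, (coe_mem_pisotGenerators_iff (x := ((b + b : 𝓞 K) : K))).2 ⟨(b + b).2, ?_, ?_⟩⟩
    · push_cast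
      linarith
    · intro σ hσ
      have := hlt _ (mk_ne_mk_inclusionEmbedding hσ)
      rw [InfinitePlace.apply] at this
      push_cast
      rw [map_add]
      linarith [norm_add_le (σ b) (σ b)]
  rcases le_abs.1 h1 with h | h
  · exact key a h hlt
  · refine key (-a) (by push_cast; exact h) fun w hw => ?_
    have h := hlt w hw
    rw [← InfinitePlace.norm_embedding_eq] at h ⊢
    push_cast
    rwa [map_neg, norm_neg]

/-! ### Simultaneous recurrence of arguments -/

theorem Circle.frequently_half_lt_re_pow {ι : Type*} (u : ι → Circle) [Finite ι] :
    ∃ᶠ q : ℕ in atTop, ∀ i, 1 / 2 < ((u i : ℂ) ^ q).re := by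
  have h := mapClusterPt_one_atTop_pow u
  have hs : {v : ι → Circle | ∀ i, 1 / 2 < ((v i : ℂ)).re} ∈ 𝓝 (1 : ι → Circle) := by
    apply IsOpen.mem_nhds
    · rw [Set.ofPred_forall]
      exact isOpen_iInter_of_finite fun i => isOpen_lt continuous_const (by fun_prop)
    · intro i
      norm_num
  exact (h.frequently hs).mono fun q hq i => by simpa using hq i

/-- |ru - 1|² = 1 - r(2 Re u - r), and 2 Re u > 1 ≥ r. -/
theorem norm_mul_sub_one_lt {r : ℝ} (hr : 0 < r) (hr1 : r ≤ 1) {u : ℂ} (hu : ‖u‖ = 1)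
    (hre : 1 / 2 < u.re) : ‖r * u - 1‖ < 1 := by
  have h2 : u.re * u.re + u.im * u.im = 1 := by
    rw [← Complex.normSq_apply, Complex.normSq_eq_norm_sq, hu, one_pow]
  have h3 : (r * r) * (u.re * u.re + u.im * u.im) = r * r := by rw [h2, mul_one]
  rw [← sq_lt_one_iff₀ (norm_nonneg _), ← Complex.normSq_eq_norm_sq, Complex.normSq_apply]
  simp only [Complex.sub_re, Complex.mul_re, Complex.ofReal_re, Complex.ofReal_im, zero_mul,
    sub_zero, Complex.one_re, Complex.sub_im, Complex.mul_im, add_zero, Complex.one_im]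
  nlinarith [mul_pos hr (sub_pos.2 hre), mul_nonneg hr.le (sub_nonneg.2 hr1)]

theorem frequently_norm_pow_sub_one_lt {ι : Type*} [Finite ι] (z : ι → ℂ) (h0 : ∀ i, z i ≠ 0)
    (h1 : ∀ i, ‖z i‖ ≤ 1) : ∃ᶠ q : ℕ in atTop, ∀ i, ‖z i ^ q - 1‖ < 1 := by
  have hu : ∀ i, ‖z i / ‖z i‖‖ = 1 := fun i => by
    rw [norm_div, Complex.norm_real, norm_norm, div_self (norm_ne_zero_iff.2 (h0 i))]
  refine (Circle.frequently_half_lt_re_pow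
    fun i => (⟨z i / ‖z i‖, mem_sphere_zero_iff_norm.2 (hu i)⟩ : Circle)).mono fun q hq i => ?_
  have h := norm_mul_sub_one_lt (r := ‖z i‖ ^ q) (pow_pos (norm_pos_iff.2 (h0 i)) q)
    (pow_le_one₀ (norm_nonneg _) (h1 i)) (by rw [norm_pow, hu, one_pow]) (hq i)
  rwa [Complex.ofReal_pow, ← mul_pow,
    mul_div_cancel₀ _ (Complex.ofReal_ne_zero.2 (norm_ne_zero_iff.2 (h0 i)))] at h

/-! ### Powers of a dominant integer -/

namespace IsDominantInteger

variable {K : IntermediateField ℚ ℝ} {x : K}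

theorem pow (hx : IsDominantInteger K x) {q : ℕ} (hq : q ≠ 0) : IsDominantInteger K (x ^ q) := by
  refine ⟨hx.1.pow q, ?_, fun σ hσ => ?_⟩
  · push_cast
    exact one_lt_pow₀ hx.2.1 hq
  · rw [map_pow, norm_pow]
    exact pow_lt_one₀ (norm_nonneg _) (hx.2.2 σ hσ) hq

theorem ne_zero (hx : IsDominantInteger K x) : x ≠ 0 := by
  rintro rfl
  have := hx.2.1
  norm_num at this

theorem tendsto_pow (hx : IsDominantInteger K x) :
    Tendsto (fun q : ℕ => (x : ℝ) ^ q) atTop atTop :=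
  tendsto_pow_atTop_atTop_of_one_lt hx.2.1

variable [FiniteDimensional ℚ K]

theorem eventually_norm_pow_lt (hx : IsDominantInteger K x) {B : (K →+* ℂ) → ℝ}
    (hB : ∀ σ, σ ≠ inclusionEmbedding K → 0 < B σ) :
    ∀ᶠ q : ℕ in atTop, ∀ σ : K →+* ℂ, σ ≠ inclusionEmbedding K → ‖σ x ^ q‖ < B σ := by
  have : NumberField K := { to_finiteDimensional := inferInstance }
  rw [eventually_all]
  intro σ
  by_cases hσ : σ = inclusionEmbedding K
  · exact Eventually.of_forall fun _ h => (h hσ).elim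
  · have h := tendsto_pow_atTop_nhds_zero_of_lt_one (norm_nonneg (σ x)) (hx.2.2 σ hσ)
    filter_upwards [h.eventually_lt_const (hB σ hσ)] with q hq _
    rwa [norm_pow]

theorem frequently_norm_pow_sub_one_lt (hx : IsDominantInteger K x) :
    ∃ᶠ q : ℕ in atTop, ∀ σ : K →+* ℂ, σ ≠ inclusionEmbedding K → ‖σ x ^ q - 1‖ < 1 := by
  have : NumberField K := { to_finiteDimensional := inferInstance }
  exact (_root_.frequently_norm_pow_sub_one_lt
    (fun σ : {σ : K →+* ℂ // σ ≠ inclusionEmbedding K} => σ.1 x)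
    (fun σ => (map_ne_zero σ.1).2 hx.ne_zero) (fun σ => (hx.2.2 σ.1 σ.2).le)).mono
    fun q hq σ hσ => hq ⟨σ, hσ⟩

theorem frequently_pow_sub_one (hx : IsDominantInteger K x) :
    ∃ᶠ q : ℕ in atTop, q ≠ 0 ∧ IsDominantInteger K (x ^ q - 1) := by
  refine (hx.frequently_norm_pow_sub_one_lt.and_eventually ((eventually_ne_atTop 0).and
    (hx.tendsto_pow.eventually_gt_atTop 2))).mono fun q ⟨hq, h0, h2⟩ => ⟨h0, ?_⟩
  refine ⟨(hx.1.pow q).sub isIntegral_one, ?_, fun σ hσ => ?_⟩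
  · push_cast
    linarith
  · rw [map_sub, map_pow, map_one]
    exact hq σ hσ

theorem eventually_pow_sub_self (hx : IsDominantInteger K x) :
    ∀ᶠ q : ℕ in atTop, IsDominantInteger K (x ^ q - x) := by
  filter_upwards [hx.eventually_norm_pow_lt (B := fun σ => 1 - ‖σ x‖)
    (fun σ hσ => sub_pos.2 (hx.2.2 σ hσ)), hx.tendsto_pow.eventually_gt_atTop (1 + x)]
    with q hq h2
  refine ⟨(hx.1.pow q).sub hx.1, ?_, fun σ hσ => ?_⟩
  · push_cast
    linarith
  · rw [map_sub, map_pow]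
    linarith [norm_sub_le (σ x ^ q) (σ x), hq σ hσ]

end IsDominantInteger

theorem exists_ne_inclusionEmbedding {K : IntermediateField ℚ ℝ} [FiniteDimensional ℚ K]
    (hK : K ≠ ⊥) : ∃ σ : K →+* ℂ, σ ≠ inclusionEmbedding K := by
  have : NumberField K := { to_finiteDimensional := inferInstance }
  have h1 : Fintype.card (K →+* ℂ) ≠ 1 := by
    rw [Embeddings.card, Ne, IntermediateField.finrank_eq_one_iff]
    exact hK
  have : Nontrivial (K →+* ℂ) :=
    Fintype.one_lt_card_iff_nontrivial.1
      (lt_of_le_of_ne (Fintype.card_pos_iff.2 ⟨inclusionEmbedding K⟩) h1.symm)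
  exact exists_ne _

/-! ### Differences and gaps -/

section Generators

variable {K : IntermediateField ℚ ℝ} [FiniteDimensional ℚ K]

theorem infinite_setOf_pow_mem_pisotGenerators {α : ℝ} (hα : α ∈ pisotGenerators K) :
    {q : ℕ | α ^ q ∈ pisotGenerators K ∧ α ^ q - 1 ∈ pisotGenerators K}.Infinite := by
  obtain ⟨x, rfl, hx⟩ := mem_pisotGenerators_iff.1 hα
  refine Nat.frequently_atTop_iff_infinite.1 (hx.frequently_pow_sub_one.mono ?_)
  rintro q ⟨h0, hq⟩
  exact ⟨mem_pisotGenerators_iff.2 ⟨_, by push_cast; rfl, hx.pow h0⟩,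
    mem_pisotGenerators_iff.2 ⟨_, by push_cast; rfl, hq⟩⟩

theorem infinite_setOf_pair_sub_eq_one (K : IntermediateField ℚ ℝ) [FiniteDimensional ℚ K] :
    {p : ℝ × ℝ | p.1 ∈ pisotGenerators K ∧ p.2 ∈ pisotGenerators K ∧ p.1 - p.2 = 1}.Infinite := by
  obtain ⟨α, hα⟩ := pisotGenerators_nonempty K
  refine ((infinite_setOf_pow_mem_pisotGenerators hα).image
    (f := fun q => (α ^ q, α ^ q - 1)) ?_).mono ?_
  · intro a _ b _ hab
    exact pow_right_injective₀ (by linarith [hα.1.2.1]) hα.1.2.1.ne' (Prod.ext_iff.1 hab).1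
  · rintro _ ⟨q, hq, rfl⟩
    exact ⟨hq.1, hq.2, by simp⟩

theorem one_mem_pisotDifferences (K : IntermediateField ℚ ℝ) [FiniteDimensional ℚ K] :
    (1 : ℝ) ∈ pisotDifferences K := by
  obtain ⟨p, h1, h2, h3⟩ := (infinite_setOf_pair_sub_eq_one K).nonempty
  exact ⟨one_pos, _, h1, _, h2, h3.symm⟩

theorem pisotGenerators_ssubset_pisotDifferences (K : IntermediateField ℚ ℝ)
    [FiniteDimensional ℚ K] : pisotGenerators K ⊂ pisotDifferences K := by
  refine (Set.ssubset_iff_of_subset fun α hα => ?_).2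
    ⟨1, one_mem_pisotDifferences K, fun h => lt_irrefl _ h.1.2.1⟩
  obtain ⟨x, rfl, hx⟩ := mem_pisotGenerators_iff.1 hα
  obtain ⟨q, hq, h0⟩ := (hx.eventually_pow_sub_self.and (eventually_ne_atTop 0)).exists
  refine ⟨by linarith [hx.2.1], _, coe_mem_pisotGenerators_iff.2 (hx.pow h0), _,
    coe_mem_pisotGenerators_iff.2 hq, ?_⟩
  push_cast
  ring

theorem infinite_pisotDifferences_diff_pisotGenerators (hK : K ≠ ⊥) :
    (pisotDifferences K \ pisotGenerators K).Infinite := by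
  obtain ⟨α, hα⟩ := pisotGenerators_nonempty K
  obtain ⟨x, rfl, hx⟩ := mem_pisotGenerators_iff.1 hα
  obtain ⟨σ, hσ⟩ := exists_ne_inclusionEmbedding hK
  obtain ⟨n, hn, hn0⟩ :=
    (hx.frequently_norm_pow_sub_one_lt.and_eventually (eventually_ne_atTop 0)).exists
  -- Being within distance 1 of 1 forces a positive real part, which then serves as the bound on
  -- |τ(x)^q|.
  have hre : ∀ τ : K →+* ℂ, τ ≠ inclusionEmbedding K → 0 < (τ x ^ n).re := fun τ hτ => by
    have := (Complex.abs_re_le_norm _).trans_lt (hn τ hτ)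
    rw [Complex.sub_re, Complex.one_re] at this
    linarith [(abs_lt.1 this).1]
  have hfreq := hx.frequently_pow_sub_one.and_eventually ((hx.eventually_norm_pow_lt hre).and
    (hx.tendsto_pow.eventually_gt_atTop ((x : ℝ) ^ n + 1)))
  refine ((Nat.frequently_atTop_iff_infinite.1 hfreq).image
    (f := fun q => (x : ℝ) ^ q - 1 - (x : ℝ) ^ n) ?_).mono ?_
  · intro a _ b _ hab
    have hab : (x : ℝ) ^ a - 1 - (x : ℝ) ^ n = (x : ℝ) ^ b - 1 - (x : ℝ) ^ n := hab
    exact pow_right_injective₀ (by linarith [hx.2.1]) hx.2.1.ne'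
      (show (x : ℝ) ^ a = (x : ℝ) ^ b by linarith)
  · rintro _ ⟨q, ⟨⟨-, hq⟩, hlt, hgt⟩, rfl⟩
    refine ⟨⟨by linarith, _, coe_mem_pisotGenerators_iff.2 hq, _,
      coe_mem_pisotGenerators_iff.2 (hx.pow hn0), by push_cast; rfl⟩, fun hmem => ?_⟩
    have hd : IsDominantInteger K (x ^ q - 1 - x ^ n) := by
      apply coe_mem_pisotGenerators_iff.1
      push_cast
      exact hmem
    -- Since Re σ(x)^q < Re σ(x)^n, the conjugate has real part below -1.
    have h1 := (Complex.abs_re_le_norm _).trans_lt (hd.2.2 σ hσ)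
    rw [map_sub, map_sub, map_pow, map_pow, map_one, Complex.sub_re, Complex.sub_re,
      Complex.one_re] at h1
    linarith [(abs_lt.1 h1).1, (Complex.re_le_norm _).trans_lt (hlt σ hσ)]

theorem finite_pisotGenerators_inter_Iic (K : IntermediateField ℚ ℝ) [FiniteDimensional ℚ K]
    (B : ℝ) : (pisotGenerators K ∩ Set.Iic B).Finite := by
  have : NumberField K := { to_finiteDimensional := inferInstance }
  refine ((Embeddings.finite_of_norm_le K ℂ (max B 1)).image (fun x : K => (x : ℝ))).subset ?_
  rintro θ ⟨hθ, hB⟩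
  obtain ⟨x, rfl, hx⟩ := mem_pisotGenerators_iff.1 hθ
  refine ⟨x, ⟨hx.1, fun σ => ?_⟩, rfl⟩
  by_cases hσ : σ = inclusionEmbedding K
  · rw [hσ, inclusionEmbedding_apply, Complex.norm_real, Real.norm_eq_abs,
      abs_of_pos (by linarith [hx.2.1])]
    exact le_max_of_le_left hB
  · exact le_max_of_le_right (hx.2.2 σ hσ).le

theorem exists_sub_mem_pisotGaps {a : ℝ} (ha : a ∈ pisotGenerators K) :
    ∃ b ∈ pisotGenerators K, b - a ∈ pisotGaps K := by
  obtain ⟨x, rfl, hx⟩ := mem_pisotGenerators_iff.1 ha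
  obtain ⟨q, hq, h0⟩ :=
    ((hx.tendsto_pow.eventually_gt_atTop (x : ℝ)).and (eventually_ne_atTop 0)).exists
  have hmem : (x : ℝ) ^ q ∈ pisotGenerators K := by
    have := coe_mem_pisotGenerators_iff.2 (hx.pow h0)
    push_cast at this
    exact this
  obtain ⟨b, ⟨hb, hbq, hxb⟩, hmin⟩ := Set.exists_min_image
    (pisotGenerators K ∩ (Set.Iic ((x : ℝ) ^ q) ∩ Set.Ioi (x : ℝ))) id
    ((finite_pisotGenerators_inter_Iic K ((x : ℝ) ^ q)).subset fun y hy => ⟨hy.1, hy.2.1⟩)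
    ⟨_, hmem, Set.self_mem_Iic, hq⟩
  refine ⟨b, hb, x, ha, b, hb, hxb, fun c hc h => ?_, rfl⟩
  exact (hmin c ⟨hc, h.2.le.trans hbq, h.1⟩).not_gt h.2

/-- Under a non-inclusion σ all terms stay in the unit disc, so k|σ(c)| < 2 for every k. -/
theorem eq_zero_of_forall_add_mul_mem_pisotGenerators (hK : K ≠ ⊥) {a c : ℝ}
    (h : ∀ k : ℕ, a + k * c ∈ pisotGenerators K) : c = 0 := by
  obtain ⟨σ, hσ⟩ := exists_ne_inclusionEmbedding hK
  obtain ⟨x, hxa, hx⟩ := mem_pisotGenerators_iff.1 (h 0)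
  obtain ⟨y, hya, hy⟩ := mem_pisotGenerators_iff.1 (h 1)
  have hc : ((y - x : K) : ℝ) = c := by
    push_cast
    rw [hxa, hya]
    push_cast
    ring
  have hk : ∀ k : ℕ, k * ‖σ (y - x)‖ < 2 := fun k => by
    have h1 : IsDominantInteger K (x + k * (y - x)) := by
      apply coe_mem_pisotGenerators_iff.1
      have hxa : (x : ℝ) = a := by simpa using hxa
      have := h k
      rw [← hc, ← hxa] at this
      push_cast at this ⊢
      exact this
    have h2 := h1.2.2 σ hσ
    rw [map_add, map_mul, map_natCast] at h2
    have h3 := norm_sub_le (σ x + k * σ (y - x)) (σ x)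
    rw [add_sub_cancel_left, norm_mul, Complex.norm_natCast] at h3
    linarith [hx.2.2 σ hσ]
  have h0 : σ (y - x) = 0 := by
    by_contra hne
    obtain ⟨k, hk'⟩ := exists_nat_gt (2 / ‖σ (y - x)‖)
    rw [div_lt_iff₀ (norm_pos_iff.2 hne)] at hk'
    exact lt_asymm hk' (hk k)
  rw [← hc, (map_eq_zero σ).1 h0]
  rfl

theorem two_le_encard_pisotGaps (hK : K ≠ ⊥) : 2 ≤ (pisotGaps K).encard := by
  by_contra hlt
  rw [not_le, ← one_add_one_eq_two, ENat.lt_add_one_iff ENat.one_ne_top,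
    Set.encard_le_one_iff] at hlt
  obtain ⟨a, ha⟩ := pisotGenerators_nonempty K
  obtain ⟨b, hb, hab⟩ := exists_sub_mem_pisotGaps ha
  have hmem : ∀ k : ℕ, a + k * (b - a) ∈ pisotGenerators K := by
    intro k
    induction k with
    | zero => simpa using ha
    | succ k ih =>
      obtain ⟨d, hd, hgap⟩ := exists_sub_mem_pisotGaps ih
      have h := hlt _ _ hgap hab
      convert! hd using 1
      push_cast
      linarith
  have h0 := eq_zero_of_forall_add_mul_mem_pisotGenerators hK hmem
  obtain ⟨u, -, v, -, huv, -, h⟩ := hab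
  linarith

end Generators

theorem theorem1p1 (K : IntermediateField ℚ ℝ) [FiniteDimensional ℚ K] :
    ((1 : ℝ) ∈ pisotDifferences K ∧
      {p : ℝ × ℝ | p.1 ∈ pisotGenerators K ∧ p.2 ∈ pisotGenerators K ∧
        p.1 - p.2 = 1}.Infinite ∧
      ∀ α ∈ pisotGenerators K,
        {q : ℕ | α ^ q ∈ pisotGenerators K ∧ α ^ q - 1 ∈ pisotGenerators K}.Infinite) ∧
    pisotGenerators K ⊂ pisotDifferences K ∧
    (K ≠ ⊥ →
      (pisotDifferences K \ pisotGenerators K).Infinite ∧ 2 ≤ (pisotGaps K).encard) :=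
  ⟨⟨one_mem_pisotDifferences K, infinite_setOf_pair_sub_eq_one K,
    fun _ hα => infinite_setOf_pow_mem_pisotGenerators hα⟩,
    pisotGenerators_ssubset_pisotDifferences K,
    fun hK => ⟨infinite_pisotDifferences_diff_pisotGenerators hK, two_le_encard_pisotGaps hK⟩⟩
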